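/- Let $\mathcal H_A,\mathcal H_B$ be nonzero finite-dimensional complex Hilbert spaces of dimensions $d_A,d_B$, let $U$ be a unitary operator on $\mathcal H_A\otimes\mathcal H_B$, and let $\mathcal U(\rho)=U\rho U^\dagger$. **Definitions.** A *local decomposition* $\Gamma$ of $U$ consists of an integer $m\ge1$, a vector $c\in\mathbb R^m$ and unitaries $V_1,\dots,V_m$ on $\mathcal H_A$ and $W_1,\dots,W_m$ on $\mathcal H_B$ with $U=\sum_{j=1}^m c_j\,V_j\otimes W_j$. Its magnitude is $\phi(\Gamma)=2\|c\|_1^2-\|c\|_2^2$, and the *product extent* $\xi(U)$ is the minimum (infimum) of $\phi(\Gamma)$ over all local decompositions of $U$. The decomposition is an *operator Schmidt decomposition* if $\operatorname{Tr}(V_j^\dagger V_k)=d_A\delta_{jk}$, $\operatorname{Tr}(W_j^\dagger W_k)=d_B\delta_{jk}$, $c_j>0$ for all $j,k$, and $\sum_j c_j^2=1$. A *space-like cut* of a linear map $\mathcal N$ on $\mathsf L(\mathcal H_A\otimes\mathcal H_B)$ is a finite decomposition $\mathcal N=\sum_i a_i\,(\mathrm{id}_{AB}\otimes\mathcal T_i)\circ\mathcal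 E_i$ with $a_i\in\mathbb R$, where, for finite-dimensional ancilla systems $R_A,R_B$, each $\mathcal E_i\colon\mathsf L(\mathcal H_{AB})\to\mathsf L(\mathcal H_{AR_ABR_B})$ is a channel implementable by (finitely many rounds of) local operations and classical communication between the two parties, and $\mathcal T_i(X)=\operatorname{Tr}\big((O_i^{(A)}\otimes O_i^{(B)})X\big)$ for operators $O_i^{(A)}$ on $\mathcal H_{R_A}$ and $O_i^{(B)}$ on $\mathcal H_{R_B}$ with $\|O_i^{(A)}\otimes O_i^{(B)}\|\le1$. Its *1-norm* is $\sum_i|a_i|$. The cut is *local* if each $\mathcal E_i$ is a tensor product of isometric channels $A\to AR_A$ and $B\to BR_B$. The *gamma factor* $\gamma(\mathcal N)$ is the infimum of the 1-norms of all space-like cuts of $\mathcal N$. The *double Hadamard test* of $\Gamma$ is the following family, with $R_A$ and $R_B$ single qubits, indexed by $(i,j,g)\in[m]\times[m]\times\{0,1\}$. The coefficient is $(-1)^g c_ic_j$, except that it is $0$ if $i=j$ and $g=1$; the operators on the ancilla qubits are $\sigma_z$ and $\sigma_z$; and the channel is $\rho\mapsto(K\otimes L)\rho(K\otimes L)^\dagger$,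 where $K\colon\mathcal H_A\to\mathcal H_A\otimes\mathbb C^2$ adjoins an ancilla qubit in the state $|0\rangle$ and then applies a Hadamard gate to the ancilla, the controlled gate $V_i\otimes|0\rangle\langle0|+V_j\otimes|1\rangle\langle1|$, the gate $S^g$ with $S=\mathrm{diag}(1,\mathrm i)$ to the ancilla, and again a Hadamard gate to the ancilla, and $L\colon\mathcal H_B\to\mathcal H_B\otimes\mathbb C^2$ is the same with $W_i,W_j$ in place of $V_i,V_j$. **Theorem.** For every local decomposition $\Gamma$ of $U$, the double Hadamard test of $\Gamma$ is a local space-like cut of $\mathcal U$ (with $d_{R_A}=d_{R_B}=2$), and its 1-norm is $\phi(\Gamma)=2\|c\|_1^2-\|c\|_2^2$. If moreover $\Gamma$ is an operator Schmidt decomposition, then $$\phi(\Gamma)=\xi(U)=\gamma(\mathcal U)=2\|c\|_1^2-1 .$$ -/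

import Mathlib

open scoped Kronecker

noncomputable section

namespace SpaceLikeCutting

/-- Linear maps `L(ℂ^a) → L(ℂ^b)`. A system with Hilbert space of dimension `d` is given by a
finite index type of cardinality `d` labelling an orthonormal basis, operators are matrices. -/
abbrev SuperOp (a b : Type) : Type := Matrix a a ℂ →ₗ[ℂ] Matrix b b ℂ

/-- The map `X ↦ M X Mᴴ`. -/
def conjMap {a b : Type} [Fintype a] (M : Matrix b a ℂ) : SuperOp a b where
  toFun X := M * X * M.conjTranspose
  map_add' X Y := by rw [Matrix.mul_add, Matrix.add_mul]
  map_smul' r X := by rw [Matrix.mul_smul, Matrix.smul_mul]; rfl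

/-- The operator norm (Schatten `∞`-norm) of a matrix. -/
def opNorm {n : Type} [Fintype n] [DecidableEq n] (M : Matrix n n ℂ) : ℝ :=
  ‖Matrix.toEuclideanCLM (n := n) (𝕜 := ℂ) M‖

/-- Channels `L(ℂ^a ⊗ ℂ^b) → L(ℂ^a' ⊗ ℂ^b')` implementable by finitely many rounds of local
operations and classical communication between the two parties. The protocol either ends with a
pair of local channels (given by Kraus operators), or one party performs a local measurement
with Kraus operators `K x` (the output system may differ from the input system), announces the
outcome `x`, and the parties go on with an LOCC protocol that depends on `x`. -/
inductive IsLOCC {a' b' : Type} [Fintype a'] [Fintype b'] :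
    ∀ (a b : Type) [Fintype a] [DecidableEq a] [Fintype b] [DecidableEq b],
      SuperOp (a × b) (a' × b') → Prop
  | localOps {a b κ μ : Type} [Fintype a] [DecidableEq a] [Fintype b] [DecidableEq b]
      [Fintype κ] [Fintype μ] (K : κ → Matrix a' a ℂ) (L : μ → Matrix b' b ℂ)
      (hK : ∑ x, (K x).conjTranspose * K x = 1) (hL : ∑ y, (L y).conjTranspose * L y = 1) :
      IsLOCC a b (∑ x, ∑ y, conjMap (K x ⊗ₖ L y))
  | alice {a b c κ : Type} [Fintype a] [DecidableEq a] [Fintype b] [DecidableEq b]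
      [Fintype c] [DecidableEq c] [Fintype κ] (K : κ → Matrix c a ℂ)
      (hK : ∑ x, (K x).conjTranspose * K x = 1)
      (F : κ → SuperOp (c × b) (a' × b')) (hF : ∀ x, IsLOCC c b (F x)) :
      IsLOCC a b (∑ x, (F x).comp (conjMap (K x ⊗ₖ (1 : Matrix b b ℂ))))
  | bob {a b c κ : Type} [Fintype a] [DecidableEq a] [Fintype b] [DecidableEq b]
      [Fintype c] [DecidableEq c] [Fintype κ] (K : κ → Matrix c b ℂ)
      (hK : ∑ x, (K x).conjTranspose * K x = 1)
      (F : κ → SuperOp (a × c) (a' × b')) (hF : ∀ x, IsLOCC a c (F x)) :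
      IsLOCC a b (∑ x, (F x).comp (conjMap ((1 : Matrix a a ℂ) ⊗ₖ K x)))

/-- The map `id_AB ⊗ 𝒯` with `𝒯 X = Tr (O X)`, i.e. `X ↦ Tr_{RA RB} ((1_AB ⊗ O) X)`. -/
def postProcess {A B RA RB : Type} [Fintype RA] [Fintype RB]
    (O : Matrix (RA × RB) (RA × RB) ℂ) : SuperOp ((A × RA) × (B × RB)) (A × B) where
  toFun X := Matrix.of fun p q =>
    ∑ r : RA × RB, ∑ s : RA × RB, O r s * X ((p.1, s.1), (p.2, s.2)) ((q.1, r.1), (q.2, r.2))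
  map_add' X Y := by
    ext p q
    simp [mul_add, Finset.sum_add_distrib]
  map_smul' r X := by
    ext p q
    simp [Finset.mul_sum, mul_left_comm]

/-- The ingredients of a cut: real coefficients `a i`, maps `ℰ i : L(AB) → L(A RA B RB)` and
local operators `O_A i`, `O_B i` on the ancilla systems. -/
structure CutData (ι A B RA RB : Type) where
  coeff : ι → ℝ
  chan : ι → SuperOp (A × B) ((A × RA) × (B × RB))
  obsA : ι → Matrix RA RA ℂ
  obsB : ι → Matrix RB RB ℂ

namespace CutData

variable {ι A B RA RB : Type} [Fintype ι] [Fintype A] [DecidableEq A] [Fintype B] [DecidableEq B]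
  [Fintype RA] [DecidableEq RA] [Fintype RB] [DecidableEq RB]

/-- The data form a space-like cut of `N`. -/
structure IsSpaceLikeCut (D : CutData ι A B RA RB) (N : SuperOp (A × B) (A × B)) : Prop where
  locc : ∀ i, IsLOCC A B (D.chan i)
  norm_obs_le : ∀ i, opNorm (D.obsA i ⊗ₖ D.obsB i) ≤ 1
  decomp : N = ∑ i, (D.coeff i : ℂ) • (postProcess (D.obsA i ⊗ₖ D.obsB i)).comp (D.chan i)

/-- Every `ℰ i` is a tensor product of isometric channels `A → A RA` and `B → B RB`. -/
def IsLocal (D : CutData ι A B RA RB) : Prop :=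
  ∀ i, ∃ (V : Matrix (A × RA) A ℂ) (W : Matrix (B × RB) B ℂ),
    V.conjTranspose * V = 1 ∧ W.conjTranspose * W = 1 ∧ D.chan i = conjMap (V ⊗ₖ W)

/-- The 1-norm of the vector of coefficients. -/
def oneNorm (D : CutData ι A B RA RB) : ℝ := ∑ i, |D.coeff i|

end CutData

variable {A B : Type} [Fintype A] [DecidableEq A] [Fintype B] [DecidableEq B]

/-- The gamma factor: the infimum of the 1-norms of all space-like cuts of `N`, with any finite
number of terms and ancilla systems of any finite dimension. -/
def gammaFactor (N : SuperOp (A × B) (A × B)) : ℝ :=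
  sInf {t : ℝ | ∃ (m rA rB : ℕ) (D : CutData (Fin m) A B (Fin rA) (Fin rB)),
    D.IsSpaceLikeCut N ∧ D.oneNorm = t}

/-- The channel `ρ ↦ U ρ Uᴴ`. -/
def unitaryChannel (U : Matrix.unitaryGroup (A × B) ℂ) : SuperOp (A × B) (A × B) :=
  conjMap (U : Matrix (A × B) (A × B) ℂ)

/-- A local decomposition `(c i, V i ⊗ W i)`, `i = 1, …, m`, `m > 0`, with `c i` real and
`V i`, `W i` unitary. -/
structure LocalDecomposition (A B : Type) [Fintype A] [DecidableEq A] [Fintype B]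
    [DecidableEq B] where
  m : ℕ
  m_pos : 0 < m
  c : Fin m → ℝ
  V : Fin m → Matrix.unitaryGroup A ℂ
  W : Fin m → Matrix.unitaryGroup B ℂ

/-- The Hadamard gate. -/
def hadamardGate : Matrix (Fin 2) (Fin 2) ℂ := ((√2 : ℝ) : ℂ)⁻¹ • !![1, 1; 1, -1]

/-- The gate `G`: the identity for `g = 0`, the phase gate `S` for `g = 1`. -/
def phaseGate (g : Fin 2) : Matrix (Fin 2) (Fin 2) ℂ :=
  if g = 0 then 1 else !![1, 0; 0, Complex.I]

/-- The Pauli matrix `σ_z`. -/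
def pauliZ : Matrix (Fin 2) (Fin 2) ℂ := !![1, 0; 0, -1]

/-- The gate that applies `X` if the ancilla qubit is in state `0` and `Y` if it is in
state `1`. -/
def controlledGate (X Y : Matrix A A ℂ) : Matrix (A × Fin 2) (A × Fin 2) ℂ :=
  X ⊗ₖ Matrix.single 0 0 1 + Y ⊗ₖ Matrix.single 1 1 1

/-- The isometry `ψ ↦ ψ ⊗ |0⟩` that adds an ancilla qubit. -/
def addAncilla (A : Type) [DecidableEq A] : Matrix (A × Fin 2) A ℂ :=
  Matrix.of fun p i => if p.1 = i ∧ p.2 = 0 then 1 else 0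

/-- One half of the circuit: an ancilla qubit is prepared in state `0`, then the Hadamard gate,
the controlled gate, the gate `G` and the Hadamard gate are applied. -/
def hadamardTestIsometry (X Y : Matrix A A ℂ) (g : Fin 2) : Matrix (A × Fin 2) A ℂ :=
  ((1 : Matrix A A ℂ) ⊗ₖ hadamardGate) * ((1 : Matrix A A ℂ) ⊗ₖ phaseGate g) *
    controlledGate X Y * ((1 : Matrix A A ℂ) ⊗ₖ hadamardGate) * addAncilla A

namespace LocalDecomposition

/-- `U = ∑ i, c i • V i ⊗ W i`. -/
def IsValidFor (Γ : LocalDecomposition A B) (U : Matrix.unitaryGroup (A × B) ℂ) : Prop :=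
  (U : Matrix (A × B) (A × B) ℂ) =
    ∑ i, (Γ.c i : ℂ) • ((Γ.V i : Matrix A A ℂ) ⊗ₖ (Γ.W i : Matrix B B ℂ))

/-- The magnitude `φ(Γ) = 2 ‖c‖₁² - ‖c‖₂²`. -/
def magnitude (Γ : LocalDecomposition A B) : ℝ :=
  2 * (∑ i, |Γ.c i|) ^ 2 - ∑ i, Γ.c i ^ 2

/-- The decomposition is an operator Schmidt decomposition (with unitary Schmidt operators). -/
structure IsOperatorSchmidt (Γ : LocalDecomposition A B) : Prop where
  trace_V : ∀ j k, ((Γ.V j : Matrix A A ℂ).conjTranspose * (Γ.V k : Matrix A A ℂ)).trace =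
    if j = k then (Fintype.card A : ℂ) else 0
  trace_W : ∀ j k, ((Γ.W j : Matrix B B ℂ).conjTranspose * (Γ.W k : Matrix B B ℂ)).trace =
    if j = k then (Fintype.card B : ℂ) else 0
  c_pos : ∀ j, 0 < Γ.c j
  sum_sq : ∑ j, Γ.c j ^ 2 = 1

/-- The double Hadamard test: for a setting `(i, j, g)` the two local circuits with the controlled
gates `V i / V j` and `W i / W j` and the phase gate `G` are run, `σ_z ⊗ σ_z` is measured on the
two ancilla qubits, and the result is weighted with `(-1)^g c i c j`; the setting `g = 1` does not
occur for `i = j`. -/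
def doubleHadamardTest (Γ : LocalDecomposition A B) :
    CutData (Fin Γ.m × Fin Γ.m × Fin 2) A B (Fin 2) (Fin 2) where
  coeff := fun ⟨i, j, g⟩ => if i = j ∧ g = 1 then 0 else (-1) ^ (g : ℕ) * (Γ.c i * Γ.c j)
  chan := fun ⟨i, j, g⟩ =>
    conjMap (hadamardTestIsometry (Γ.V i : Matrix A A ℂ) (Γ.V j : Matrix A A ℂ) g ⊗ₖ
      hadamardTestIsometry (Γ.W i : Matrix B B ℂ) (Γ.W j : Matrix B B ℂ) g)
  obsA := fun _ => pauliZ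
  obsB := fun _ => pauliZ

end LocalDecomposition

/-- The product extent: the least magnitude of a valid local decomposition, as an infimum (which is
a minimum whenever it equals the magnitude of a valid decomposition). -/
def productExtent (U : Matrix.unitaryGroup (A × B) ℂ) : ℝ :=
  sInf {t : ℝ | ∃ Γ : LocalDecomposition A B, Γ.IsValidFor U ∧ Γ.magnitude = t}

end SpaceLikeCutting

end

/-! Upper bound. Expanding `U` on both sides of `ρ` gives terms `c i * c j` times `(V i ⊗ W i) ρ (V
j ⊗ W j)ᴴ`, which are paired with their adjoint counterparts. By `postProcess_pauliZ_hadamardTest`,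
a circuit of the test returns such a pair with sign `(-1)^g`, plus cross terms mixing `V i ⊗ W j`
with `V j ⊗ W i` that do not depend on `g`. Subtracting `g = 1` from `g = 0` removes the cross
terms. For `i = j` they coincide with the wanted ones, so `g = 0` suffices; this saves `‖c‖₂²`.
Hence `γ ≤ φ(Γ)` for every valid decomposition.

Lower bound, by duality. Put `G = ∑ V j ⊗ W j` for an operator Schmidt decomposition and `D = d_A
d_B`. For a map with one Kraus operator `K ⊗ L`, Cauchy-Schwarz and Bessel give `|Tr(Gᴴ (K ⊗ L))|² ≤
D Tr(KᴴK) Tr(LᴴL)`. So the linear functional `choiWitness G` is bounded in modulus on separable maps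
by the normalized trace of the Choi matrix. The terms of a cut need not be positive, but contractive
observables reduce to unitary ones, and these split spectrally into positive pieces that do give
separable maps. The bounds for the pieces add up to `Tr(Λ 1) / D = 1`, so the functional is at most
the 1-norm of any cut. On the channel of `U` it equals `2‖c‖₁² - 1`, as `Tr(Gᴴ U) = D‖c‖₁`.

The bounds meet because `‖c‖₂ = 1`. Minimality of `φ(Γ)` then also goes through `γ`, which is below
every magnitude. -/

open scoped Kronecker

noncomputable section

namespace SpaceLikeCutting

/-! ### From positive matrices to contractions -/

section Contractions

open scoped Matrix.Norms.L2Operator MatrixOrder ComplexOrder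

variable {n : Type} [Fintype n] [DecidableEq n]

/-- Spectral decomposition of a unitary matrix as a projective measurement. -/
theorem exists_posSemidef_decomposition (u : Matrix n n ℂ) (hu : u ∈ unitary (Matrix n n ℂ)) :
    ∃ (s : Finset ℂ) (E : ℂ → Matrix n n ℂ), (∀ z ∈ s, ‖z‖ = 1) ∧ (∀ z, (E z).PosSemidef) ∧
      ∑ z ∈ s, E z = 1 ∧ ∑ z ∈ s, z • E z = u := by
  classical
  have hn : IsStarNormal u := by
    rw [Unitary.mem_iff] at hu
    exact ⟨hu.1.trans hu.2.symm⟩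
  have hfin := Matrix.finite_spectrum u
  -- The spectrum is finite, so every function is continuous on it and indicators of eigenvalues
  -- give the spectral projections.
  have hc : ∀ f : ℂ → ℂ, ContinuousOn f (spectrum ℂ u) := fun f =>
    hfin.continuousOn f
  refine ⟨hfin.toFinset, fun z => cfc (fun x => if x = z then 1 else 0) u, ?_, ?_, ?_, ?_⟩
  · intro z hz
    have := spectrum.subset_circle_of_unitary hu ((Set.Finite.mem_toFinset _).1 hz)
    simpa using this
  · intro z
    rw [← Matrix.nonneg_iff_posSemidef]
    apply cfc_nonneg
    intro x _
    split_ifs <;> simp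
  · rw [← cfc_sum _ _ _ (fun i _ => hc _), ← cfc_one ℂ u]
    apply cfc_congr
    intro x hx
    have : x ∈ hfin.toFinset := by simpa using hx
    simp [Finset.sum_apply, Finset.sum_ite_eq, hx]
  · have : ∀ z : ℂ, z • cfc (fun x => if x = z then (1 : ℂ) else 0) u =
        cfc (fun x => z • if x = z then (1 : ℂ) else 0) u := fun z =>
      (cfc_smul z _ u (hc _)).symm
    simp only [this]
    rw [← cfc_sum _ _ _ (fun i _ => hc _)]
    conv_rhs => rw [← cfc_id ℂ u]
    apply cfc_congr
    intro x hx
    simp [Finset.sum_apply, Finset.sum_ite_eq, hx]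

/-- Polar decomposition: `M = w h` with `w` unitary and `h = |M|` a contraction, and `h` is the mean
of the unitaries `h ± i √(1 - h²)`. So `M` is a mean of two unitaries. -/
theorem norm_le_of_isUnit {f : Matrix n n ℂ →ₗ[ℂ] ℂ} {C : ℝ}
    (hf : ∀ u ∈ unitary (Matrix n n ℂ), ‖f u‖ ≤ C) {M : Matrix n n ℂ} (hM : ‖M‖ ≤ 1)
    (hu : IsUnit M) : ‖f M‖ ≤ C := by
  set h : Matrix n n ℂ := CFC.sqrt (star M * M) with hh
  have hpos : 0 ≤ star M * M := star_mul_self_nonneg M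
  have hsq : h * h = star M * M := CFC.sqrt_mul_sqrt_self _ hpos
  have hsa : star h = h := (CFC.sqrt_nonneg (star M * M)).isSelfAdjoint
  have hhu : IsUnit h := by
    have : IsUnit (h * h) := hsq ▸ hu.star.mul hu
    rw [Matrix.isUnit_iff_isUnit_det, Matrix.det_mul] at this
    rw [Matrix.isUnit_iff_isUnit_det]
    exact isUnit_of_mul_isUnit_left this
  have hdet : IsUnit h.det := (Matrix.isUnit_iff_isUnit_det h).1 hhu
  have hnorm : ‖h‖ ≤ 1 := by
    have h1 : ‖h‖ * ‖h‖ = ‖M‖ * ‖M‖ := by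
      rw [← CStarRing.norm_star_mul_self (x := h), hsa, hsq, CStarRing.norm_star_mul_self]
    nlinarith [norm_nonneg h, norm_nonneg M]
  set k : Matrix n n ℂ := CFC.sqrt (1 - h ^ 2)
  have hk : star k = k := (CFC.sqrt_nonneg (1 - h ^ 2)).isSelfAdjoint
  have hv : h + Complex.I • k ∈ unitary (Matrix n n ℂ) :=
    IsSelfAdjoint.self_add_I_smul_cfcSqrt_sub_sq_mem_unitary h hsa hnorm
  have hv' : h - Complex.I • k ∈ unitary (Matrix n n ℂ) := by
    have h2 := Unitary.star_mem hv
    rwa [star_add, star_smul, hsa, hk, Complex.star_def, Complex.conj_I, neg_smul,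
      ← sub_eq_add_neg] at h2
  have hw : M * h⁻¹ ∈ unitary (Matrix n n ℂ) := by
    have h3 : star (M * h⁻¹) * (M * h⁻¹) = 1 := by
      have h4 : star h⁻¹ = h⁻¹ := by
        rw [Matrix.star_eq_conjTranspose, Matrix.conjTranspose_nonsing_inv,
          ← Matrix.star_eq_conjTranspose, hsa]
      rw [star_mul, h4, mul_assoc, ← mul_assoc (star M), ← hsq, mul_assoc h,
        Matrix.mul_nonsing_inv _ hdet, mul_one, Matrix.nonsing_inv_mul _ hdet]
    exact Unitary.mem_iff.2 ⟨h3, mul_eq_one_comm.1 h3⟩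
  have hdecomp : M = (2⁻¹ : ℂ) • (M * h⁻¹ * (h + Complex.I • k) +
      M * h⁻¹ * (h - Complex.I • k)) := by
    rw [← mul_add, add_add_sub_cancel, ← two_smul ℂ h, mul_smul_comm, smul_smul, mul_assoc,
      Matrix.nonsing_inv_mul _ hdet]
    simp
  rw [hdecomp, map_smul, map_add, norm_smul]
  have h5 := hf _ (mul_mem hw hv)
  have h6 := hf _ (mul_mem hw hv')
  have h7 := norm_add_le (f (M * h⁻¹ * (h + Complex.I • k))) (f (M * h⁻¹ * (h - Complex.I • k)))
  have h8 : ‖(2⁻¹ : ℂ)‖ = 2⁻¹ := by simp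
  rw [h8]
  linarith

/-- A linear functional which is bounded by `C` on unitary matrices is bounded by `C` on
contractions. -/
theorem norm_le_of_unitary_bound {f : Matrix n n ℂ →ₗ[ℂ] ℂ} {C : ℝ}
    (hf : ∀ u ∈ unitary (Matrix n n ℂ), ‖f u‖ ≤ C) {M : Matrix n n ℂ} (hM : ‖M‖ ≤ 1) :
    ‖f M‖ ≤ C := by
  cases isEmpty_or_nonempty n with
  | inl _ =>
    rw [Subsingleton.elim M 1]
    exact hf 1 (one_mem _)
  | inr _ =>
  -- The invertible case applies to `(M + ε) / (1 + ε)`, a contraction that is invertible for all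
  -- but finitely many `ε > 0`; then `ε → 0`.
  have hT : {ε : ℝ | (ε : ℂ) ∈ spectrum ℂ (-M)}.Finite :=
    (Matrix.finite_spectrum (-M)).preimage Complex.ofReal_injective.injOn
  have hev : ∀ᶠ ε : ℝ in nhdsWithin 0 (Set.Ioi 0), ‖f M‖ ≤ (1 + ε) * C + ε * ‖f 1‖ := by
    -- Zero is removed from the exceptional set because `M` itself may be singular; only then is the
    -- complement a neighbourhood of zero.
    have h1 : ∀ᶠ ε : ℝ in nhdsWithin 0 (Set.Ioi 0),
        ε ∉ {ε : ℝ | (ε : ℂ) ∈ spectrum ℂ (-M)} \ {0} :=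
      mem_nhdsWithin_of_mem_nhds ((hT.subset Set.sdiff_subset).isClosed.isOpen_compl.mem_nhds
        (by simp))
    filter_upwards [h1, self_mem_nhdsWithin] with ε hε hpos
    have hpos' : (0 : ℝ) < ε := hpos
    have hunit : IsUnit (M + (ε : ℂ) • 1) := by
      by_contra hc
      refine hε ⟨?_, hpos'.ne'⟩
      rw [Set.mem_ofPred_eq, spectrum.mem_iff, Algebra.algebraMap_eq_smul_one, sub_neg_eq_add,
        add_comm]
      exact hc
    have hne : (1 + ε : ℂ) ≠ 0 := by
      exact_mod_cast (by linarith : (1 + ε) ≠ 0)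
    have hn : ‖(1 + ε : ℂ)‖ = 1 + ε := by
      rw [← Complex.ofReal_one, ← Complex.ofReal_add, Complex.norm_real, Real.norm_of_nonneg]
      linarith
    have hnε : ‖(ε : ℂ)‖ = ε := by
      rw [Complex.norm_real, Real.norm_of_nonneg hpos'.le]
    have hcontr : ‖(1 + ε : ℂ)⁻¹ • (M + (ε : ℂ) • (1 : Matrix n n ℂ))‖ ≤ 1 := by
      rw [norm_smul, norm_inv, hn, inv_mul_le_one₀ (by linarith)]
      refine (norm_add_le _ _).trans ?_
      rw [norm_smul, CStarRing.norm_one, hnε]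
      linarith
    have hb := norm_le_of_isUnit hf hcontr
      ((isUnit_smul_iff (Units.mk0 _ (inv_ne_zero hne)) _).2 hunit)
    have heq : f M = (1 + ε : ℂ) * f ((1 + ε : ℂ)⁻¹ • (M + (ε : ℂ) • (1 : Matrix n n ℂ))) -
        ε * f 1 := by
      rw [map_smul, map_add, map_smul, smul_eq_mul, smul_eq_mul, mul_inv_cancel_left₀ hne]
      ring
    rw [heq]
    refine (norm_sub_le _ _).trans ?_
    rw [norm_mul, norm_mul, hn, hnε]
    gcongr
  have hlim : Filter.Tendsto (fun ε : ℝ => (1 + ε) * C + ε * ‖f 1‖) (nhdsWithin 0 (Set.Ioi 0))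
      (nhds C) := by
    have : Continuous (fun ε : ℝ => (1 + ε) * C + ε * ‖f 1‖) := by fun_prop
    simpa using (this.tendsto 0).mono_left nhdsWithin_le_nhds
  exact ge_of_tendsto hlim hev

variable {k : Type} [Fintype k] [DecidableEq k]

/-- If a bilinear form `Ψ` on pairs of matrices is dominated by `N` on pairs of positive
semidefinite matrices, then it is bounded by `N 1 1` on pairs of contractions. -/
theorem norm_le_of_posSemidef_bound (Ψ N : Matrix n n ℂ →ₗ[ℂ] Matrix k k ℂ →ₗ[ℂ] ℂ)
    (h : ∀ E F, E.PosSemidef → F.PosSemidef → ‖Ψ E F‖ ≤ (N E F).re)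
    {P : Matrix n n ℂ} {Q : Matrix k k ℂ} (hP : ‖P‖ ≤ 1) (hQ : ‖Q‖ ≤ 1) :
    ‖Ψ P Q‖ ≤ (N 1 1).re := by
  refine norm_le_of_unitary_bound (f := Ψ.flip Q) (fun u hu => ?_) hP
  refine norm_le_of_unitary_bound (f := Ψ u) (fun v hv => ?_) hQ
  -- The eigenvalues have modulus one and drop out of the triangle inequality; the projections sum
  -- to `1`, which reassembles `N 1 1`.
  obtain ⟨s, E, hs, hE, hE1, hEu⟩ := exists_posSemidef_decomposition u hu
  obtain ⟨t, F, ht, hF, hF1, hFv⟩ := exists_posSemidef_decomposition v hv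
  rw [← hEu, ← hFv, ← hE1, ← hF1]
  simp only [map_sum, LinearMap.sum_apply, map_smul, LinearMap.smul_apply, Complex.re_sum]
  refine (norm_sum_le t _).trans (Finset.sum_le_sum fun z hz => ?_)
  rw [norm_smul, ht z hz, one_mul]
  refine (norm_sum_le s _).trans (Finset.sum_le_sum fun w hw => ?_)
  rw [norm_smul, hs w hw, one_mul]
  exact h _ _ (hE _) (hF _)

end Contractions

open Matrix

/-! ### Conjugation maps and Kronecker sums -/

section Maps

variable {a b c : Type} [Fintype a]

@[simp]
theorem conjMap_apply (M : Matrix b a ℂ) (X : Matrix a a ℂ) : conjMap M X = M * X * Mᴴ := rfl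

theorem conjMap_comp [Fintype b] (M : Matrix c b ℂ) (N : Matrix b a ℂ) :
    (conjMap M).comp (conjMap N) = conjMap (M * N) := by
  ext1 X
  simp [Matrix.mul_assoc]

theorem trace_conjMap [Fintype b] (M : Matrix b a ℂ) (X : Matrix a a ℂ) :
    (conjMap M X).trace = (Mᴴ * M * X).trace := by
  rw [conjMap_apply, Matrix.trace_mul_comm, ← Matrix.mul_assoc]

theorem sum_kronecker {l m n p κ : Type} [Fintype κ] (K : κ → Matrix l m ℂ) (L : Matrix n p ℂ) :
    (∑ x, K x) ⊗ₖ L = ∑ x, K x ⊗ₖ L := by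
  ext i j
  simp [Matrix.sum_apply, Finset.sum_mul]

theorem kronecker_sum {l m n p κ : Type} [Fintype κ] (K : Matrix l m ℂ) (L : κ → Matrix n p ℂ) :
    K ⊗ₖ (∑ x, L x) = ∑ x, K ⊗ₖ L x := by
  ext i j
  simp [Matrix.sum_apply, Finset.mul_sum]

end Maps

/-! ### LOCC channels are separable and trace preserving -/

section LOCC

/-- Separable maps: sums of conjugations by product Kraus operators. -/
def IsSeparable {a b a' b' : Type} [Fintype a] [Fintype b]
    (Λ : SuperOp (a × b) (a' × b')) : Prop :=
  ∃ (ι : Type) (_ : Fintype ι) (K : ι → Matrix a' a ℂ) (L : ι → Matrix b' b ℂ),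
    Λ = ∑ i, conjMap (K i ⊗ₖ L i)

theorem IsSeparable.sum {a b a' b' κ : Type} [Fintype a] [Fintype b] [Fintype κ]
    {Λ : κ → SuperOp (a × b) (a' × b')} (h : ∀ x, IsSeparable (Λ x)) :
    IsSeparable (∑ x, Λ x) := by
  choose ι hι K L hΛ using h
  refine ⟨Σ x, ι x, inferInstance, fun p => K p.1 p.2, fun p => L p.1 p.2, ?_⟩
  rw [Fintype.sum_sigma]
  exact Finset.sum_congr rfl fun x _ => hΛ x

theorem isSeparable_conjMap {a b a' b' : Type} [Fintype a] [Fintype b]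
    (K : Matrix a' a ℂ) (L : Matrix b' b ℂ) : IsSeparable (conjMap (K ⊗ₖ L)) :=
  ⟨Unit, inferInstance, fun _ => K, fun _ => L, by simp⟩

theorem IsSeparable.comp {a b c d a' b' : Type} [Fintype a] [Fintype b] [Fintype c] [Fintype d]
    {Θ : SuperOp (c × d) (a' × b')} {Λ : SuperOp (a × b) (c × d)}
    (hΘ : IsSeparable Θ) (hΛ : IsSeparable Λ) : IsSeparable (Θ.comp Λ) := by
  obtain ⟨ι, _, K, L, rfl⟩ := hΘ
  obtain ⟨κ, _, K', L', rfl⟩ := hΛ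
  have : (∑ i, conjMap (K i ⊗ₖ L i)).comp (∑ j, conjMap (K' j ⊗ₖ L' j)) =
      ∑ i, ∑ j, conjMap ((K i * K' j) ⊗ₖ (L i * L' j)) := by
    ext1 X
    simp only [LinearMap.comp_apply, LinearMap.sum_apply, map_sum, mul_kronecker_mul,
      ← conjMap_comp]
    exact Finset.sum_comm
  rw [this]
  exact IsSeparable.sum fun i => IsSeparable.sum fun j => isSeparable_conjMap _ _

/-- Together with trace preservation, this is all that the lower bound uses about LOCC. -/
theorem IsLOCC.isSeparable {a b a' b' : Type} [Fintype a] [DecidableEq a] [Fintype b]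
    [DecidableEq b] [Fintype a'] [Fintype b'] {Λ : SuperOp (a × b) (a' × b')}
    (h : IsLOCC a b Λ) : IsSeparable Λ := by
  induction h with
  | localOps K L hK hL =>
    exact IsSeparable.sum fun i => IsSeparable.sum fun j => isSeparable_conjMap _ _
  | alice K hK F hF ih => exact IsSeparable.sum fun x => (ih x).comp (isSeparable_conjMap _ _)
  | bob K hK F hF ih => exact IsSeparable.sum fun x => (ih x).comp (isSeparable_conjMap _ _)

theorem IsLOCC.trace_apply {a b a' b' : Type} [Fintype a] [DecidableEq a] [Fintype b]
    [DecidableEq b] [Fintype a'] [Fintype b'] {Λ : SuperOp (a × b) (a' × b')}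
    (h : IsLOCC a b Λ) (X : Matrix (a × b) (a × b) ℂ) : (Λ X).trace = X.trace := by
  induction h with
  | localOps K L hK hL =>
    simp only [LinearMap.sum_apply, trace_sum, trace_conjMap, conjTranspose_kronecker,
      ← mul_kronecker_mul]
    simp only [← trace_sum, ← Finset.sum_mul, ← kronecker_sum, ← sum_kronecker, hK, hL,
      one_kronecker_one, Matrix.one_mul]
  | alice K hK F hF ih =>
    simp only [LinearMap.sum_apply, LinearMap.comp_apply, ih, trace_sum, trace_conjMap,
      conjTranspose_kronecker, ← mul_kronecker_mul]
    simp only [← trace_sum, ← Finset.sum_mul, ← sum_kronecker, hK, conjTranspose_one,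
      Matrix.one_mul, one_kronecker_one]
  | bob K hK F hF ih =>
    simp only [LinearMap.sum_apply, LinearMap.comp_apply, ih, trace_sum, trace_conjMap,
      conjTranspose_kronecker, ← mul_kronecker_mul]
    simp only [← trace_sum, ← Finset.sum_mul, ← kronecker_sum, hK, conjTranspose_one,
      Matrix.one_mul, one_kronecker_one]

end LOCC

/-! ### Measuring the ancillas -/

section PostProcess

/-- The operator `1 ⊗ ⟨e|` from `A ⊗ R` to `A`, with `⟨e|` given by its coordinates. -/
def partialBra (A : Type) [DecidableEq A] {R : Type} (e : R → ℂ) : Matrix A (A × R) ℂ :=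
  Matrix.of fun x p => if x = p.1 then e p.2 else 0

theorem partialBra_apply {A R : Type} [DecidableEq A] (e : R → ℂ) (x : A) (p : A × R) :
    partialBra A e x p = if x = p.1 then e p.2 else 0 := rfl

variable {A B RA RB : Type} [Fintype RA] [Fintype RB]

theorem postProcess_apply (O : Matrix (RA × RB) (RA × RB) ℂ)
    (X : Matrix ((A × RA) × (B × RB)) ((A × RA) × (B × RB)) ℂ) (p q : A × B) :
    postProcess O X p q = ∑ r : RA × RB, ∑ s : RA × RB,
      O r s * X ((p.1, s.1), (p.2, s.2)) ((q.1, r.1), (q.2, r.2)) := rfl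

/-- `postProcess` of a product operator, as a bilinear map of the two factors. -/
def postProcessProd :
    Matrix RA RA ℂ →ₗ[ℂ] Matrix RB RB ℂ →ₗ[ℂ] SuperOp ((A × RA) × (B × RB)) (A × B) :=
  LinearMap.mk₂ ℂ (fun P Q => postProcess (P ⊗ₖ Q))
    (fun P P' Q => by
      ext1 X; ext p q
      simp [postProcess_apply, add_mul, Finset.sum_add_distrib])
    (fun z P Q => by
      ext1 X; ext p q
      simp [postProcess_apply, Finset.mul_sum, mul_assoc])
    (fun P Q Q' => by
      ext1 X; ext p q
      simp [postProcess_apply, mul_add, add_mul, Finset.sum_add_distrib])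
    (fun z P Q => by
      ext1 X; ext p q
      simp [postProcess_apply, Finset.mul_sum, mul_assoc, mul_left_comm])

theorem postProcessProd_apply (P : Matrix RA RA ℂ) (Q : Matrix RB RB ℂ) :
    postProcessProd (A := A) (B := B) P Q = postProcess (P ⊗ₖ Q) := rfl

variable [Fintype A] [Fintype B]

theorem trace_postProcess_one [DecidableEq RA] [DecidableEq RB]
    (X : Matrix ((A × RA) × (B × RB)) ((A × RA) × (B × RB)) ℂ) :
    (postProcessProd (1 : Matrix RA RA ℂ) (1 : Matrix RB RB ℂ) X).trace = X.trace := by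
  simp [postProcessProd_apply, postProcess_apply, Matrix.trace, one_apply, Fintype.sum_prod_type]
  exact Finset.sum_congr rfl fun x _ => Finset.sum_comm

variable [DecidableEq A] [DecidableEq B]

/-- A rank-one observable turns the partial trace into a sandwich between a bra and its adjoint, so
a product of two such observables gives a product Kraus operator. -/
theorem postProcessProd_vecMulVec (e : RA → ℂ) (f : RB → ℂ) :
    postProcessProd (A := A) (B := B) (vecMulVec (star e) e) (vecMulVec (star f) f) =
      conjMap (partialBra A e ⊗ₖ partialBra B f) := by
  ext1 X; ext p q
  simp only [postProcessProd_apply, postProcess_apply, conjMap_apply, Matrix.mul_apply, partialBra_apply, conjTranspose_apply, kroneckerMap_apply,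
    Fintype.sum_prod_type, vecMulVec_apply]
  simp only [mul_ite, ite_mul, mul_zero, zero_mul, star_zero, apply_ite star,
    Finset.sum_ite_irrel, Finset.sum_ite_eq, Finset.sum_const_zero, Finset.mem_univ, if_true]
  simp only [Finset.sum_mul]
  refine Finset.sum_congr rfl fun r _ => Finset.sum_congr rfl fun s _ =>
    Finset.sum_congr rfl fun t _ => Finset.sum_congr rfl fun u _ => ?_
  simp only [Pi.star_apply, star_mul']
  ring

open scoped MatrixOrder ComplexOrder in
theorem isSeparable_postProcessProd [DecidableEq RA] [DecidableEq RB] {E : Matrix RA RA ℂ}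
    {F : Matrix RB RB ℂ} (hE : E.PosSemidef) (hF : F.PosSemidef) :
    IsSeparable (postProcessProd (A := A) (B := B) E F) := by
  obtain ⟨e, rfl⟩ := CStarAlgebra.nonneg_iff_eq_star_mul_self.1 hE.nonneg
  obtain ⟨f, rfl⟩ := CStarAlgebra.nonneg_iff_eq_star_mul_self.1 hF.nonneg
  -- A positive matrix `gᴴ g` is the sum of the rank-one matrices built from the rows of `g`.
  have key : ∀ {R : Type} [Fintype R] (g : Matrix R R ℂ),
      star g * g = ∑ k, vecMulVec (star (g k)) (g k) := by
    intro R _ g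
    ext i j
    simp [Matrix.mul_apply, vecMulVec_apply, Matrix.sum_apply, star_eq_conjTranspose]
  rw [key e, key f]
  simp only [map_sum, LinearMap.sum_apply, postProcessProd_vecMulVec]
  exact IsSeparable.sum fun i => IsSeparable.sum fun j => isSeparable_conjMap _ _

end PostProcess

/-! ### Operator norm of a Kronecker product -/

section KroneckerNorm

open scoped Matrix.Norms.L2Operator

variable {m n : Type} [Fintype m] [DecidableEq m] [Fintype n] [DecidableEq n]

theorem opNorm_eq_norm (M : Matrix n n ℂ) : opNorm M = ‖M‖ := rfl

/-- Testing `P ⊗ Q` on product vectors is enough: the supremum is taken over `x` with `y` fixed,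
then over `y`. -/
theorem norm_mul_norm_le_norm_kronecker (P : Matrix m m ℂ) (Q : Matrix n n ℂ) :
    ‖P‖ * ‖Q‖ ≤ ‖P ⊗ₖ Q‖ := by
  have hten : ∀ (x : m → ℂ) (y : n → ℂ),
      ‖WithLp.toLp 2 (fun p : m × n => x p.1 * y p.2)‖ = ‖WithLp.toLp 2 x‖ * ‖WithLp.toLp 2 y‖ := by
    intro x y
    rw [← sq_eq_sq₀ (by positivity) (by positivity), mul_pow]
    simp only [EuclideanSpace.norm_sq_eq, Fintype.sum_prod_type, norm_mul, mul_pow,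
      Finset.sum_mul_sum]
  have hmul : ∀ (x : m → ℂ) (y : n → ℂ), (P ⊗ₖ Q) *ᵥ (fun p : m × n => x p.1 * y p.2) =
      fun p => (P *ᵥ x) p.1 * (Q *ᵥ y) p.2 := by
    intro x y
    ext p
    simp only [mulVec, dotProduct, Fintype.sum_prod_type, kroneckerMap_apply, Finset.sum_mul_sum]
    exact Finset.sum_congr rfl fun i _ => Finset.sum_congr rfl fun j _ => by ring
  have key : ∀ (x : EuclideanSpace ℂ m) (y : EuclideanSpace ℂ n),
      ‖toEuclideanCLM (𝕜 := ℂ) P x‖ * ‖toEuclideanCLM (𝕜 := ℂ) Q y‖ ≤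
        ‖P ⊗ₖ Q‖ * (‖x‖ * ‖y‖) := by
    intro x y
    have h := (toEuclideanCLM (𝕜 := ℂ) (P ⊗ₖ Q)).le_opNorm
      (WithLp.toLp 2 (fun p : m × n => x p.1 * y p.2))
    rw [toEuclideanCLM_toLp, hmul, hten, hten] at h
    exact h
  have hP : ∀ y : EuclideanSpace ℂ n,
      ‖P‖ * ‖toEuclideanCLM (𝕜 := ℂ) Q y‖ ≤ ‖P ⊗ₖ Q‖ * ‖y‖ := by
    intro y
    rcases (norm_nonneg (toEuclideanCLM (𝕜 := ℂ) Q y)).eq_or_lt with h0 | h0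
    · rw [← h0, mul_zero]; positivity
    · rw [← le_div_iff₀ h0]
      refine ContinuousLinearMap.opNorm_le_bound _ (by positivity) fun x => ?_
      rw [div_mul_eq_mul_div, le_div_iff₀ h0]
      exact (key x y).trans_eq (by ring)
  rcases (norm_nonneg P).eq_or_lt with h0 | h0
  · rw [← h0, zero_mul]; positivity
  · rw [mul_comm, ← le_div_iff₀ h0]
    refine ContinuousLinearMap.opNorm_le_bound _ (by positivity) fun y => ?_
    rw [div_mul_eq_mul_div, le_div_iff₀ h0]
    exact (mul_comm _ _).trans_le (hP y)

/-- A product operator which is a contraction is a product of contractions. -/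
theorem exists_contraction_kronecker {P : Matrix m m ℂ} {Q : Matrix n n ℂ}
    (h : opNorm (P ⊗ₖ Q) ≤ 1) :
    ∃ (P' : Matrix m m ℂ) (Q' : Matrix n n ℂ), ‖P'‖ ≤ 1 ∧ ‖Q'‖ ≤ 1 ∧ P ⊗ₖ Q = P' ⊗ₖ Q' := by
  rw [opNorm_eq_norm] at h
  have h1 := (norm_mul_norm_le_norm_kronecker P Q).trans h
  rcases eq_or_ne P 0 with rfl | hP
  · exact ⟨0, 0, by simp, by simp, by simp⟩
  have hP' : ‖P‖ ≠ 0 := norm_ne_zero_iff.2 hP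
  -- Only the product `‖P‖ * ‖Q‖` is bounded by `1`, so the scalar `‖P‖` is moved to the other
  -- factor.
  refine ⟨((‖P‖ : ℂ)⁻¹) • P, (‖P‖ : ℂ) • Q, ?_, ?_, ?_⟩
  · rw [norm_smul, norm_inv, Complex.norm_real, norm_norm, inv_mul_cancel₀ hP']
  · rwa [norm_smul, Complex.norm_real, norm_norm]
  · rw [smul_kronecker, kronecker_smul, smul_smul,
      inv_mul_cancel₀ (Complex.ofReal_ne_zero.2 hP'), one_smul]

end KroneckerNorm

/-! ### The witness and the lower bound -/

section Witness

/-- Bessel's inequality for the Hilbert-Schmidt inner product. -/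
theorem sum_norm_trace_sq_le {ι n : Type} [Fintype ι] [DecidableEq ι] [Fintype n] [Nonempty n]
    {V : ι → Matrix n n ℂ}
    (hV : ∀ j k, ((V j)ᴴ * V k).trace = if j = k then (Fintype.card n : ℂ) else 0)
    (K : Matrix n n ℂ) :
    ∑ j, ‖((V j)ᴴ * K).trace‖ ^ 2 ≤ Fintype.card n * (Kᴴ * K).trace.re := by
  let vec : Matrix n n ℂ → EuclideanSpace ℂ (n × n) := fun M => WithLp.toLp 2 fun p => M p.2 p.1
  have hinner : ∀ M N, inner ℂ (vec M) (vec N) = (Mᴴ * N).trace := by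
    intro M N
    simp [vec, PiLp.inner_apply, Matrix.trace, Matrix.mul_apply, Fintype.sum_prod_type, mul_comm]
  have hd : (0 : ℝ) < Fintype.card n := by exact_mod_cast Fintype.card_pos
  set d : ℝ := ((Fintype.card n : ℕ) : ℝ)
  -- Trace-orthogonal unitaries have squared Hilbert-Schmidt norm `d`, hence the factor `1/√d`.
  have horth : Orthonormal ℂ fun j => (((√d : ℝ) : ℂ)⁻¹) • vec (V j) := by
    rw [orthonormal_iff_ite]
    intro j k
    rw [inner_smul_left, inner_smul_right, hinner, hV]
    split_ifs
    · have : ((√d : ℝ) : ℂ) * ((√d : ℝ) : ℂ) = (d : ℂ) := by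
        rw [← Complex.ofReal_mul, Real.mul_self_sqrt hd.le]
      have h0 : ((√d : ℝ) : ℂ) ≠ 0 := by
        rw [Complex.ofReal_ne_zero]; positivity
      have h1 : (Fintype.card n : ℂ) = (d : ℂ) := by simp [d]
      rw [h1, ← this, map_inv₀, Complex.conj_ofReal]
      field_simp
    · simp
  have h := horth.sum_inner_products_le (s := Finset.univ) (vec K)
  have h2 : ‖vec K‖ ^ 2 = (Kᴴ * K).trace.re := by
    rw [← hinner, ← inner_self_eq_norm_sq (𝕜 := ℂ)]
    rfl
  have h3 : ∀ j, ‖inner ℂ ((((√d : ℝ) : ℂ)⁻¹) • vec (V j)) (vec K)‖ ^ 2 =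
      d⁻¹ * ‖((V j)ᴴ * K).trace‖ ^ 2 := by
    intro j
    rw [inner_smul_left, hinner, norm_mul, mul_pow, RCLike.norm_conj, norm_inv, Complex.norm_real,
      inv_pow, Real.norm_of_nonneg (Real.sqrt_nonneg _), Real.sq_sqrt hd.le]
  simp only [h3, h2, ← Finset.mul_sum] at h
  rwa [inv_mul_le_iff₀ hd] at h

variable {p : Type} [Fintype p] [DecidableEq p]

/-- Up to normalization, the overlap of the Choi matrix of `N` with the vector of `G`. -/
def choiOverlap (G : Matrix p p ℂ) : SuperOp p p →ₗ[ℂ] ℂ where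
  toFun N := ∑ x, ∑ y, (Gᴴ * N (single x y 1) * G) x y
  map_add' M N := by
    simp [Matrix.mul_add, Matrix.add_mul, Finset.sum_add_distrib]
  map_smul' z N := by
    simp [Finset.mul_sum]

/-- The trace of the Choi matrix of `N`. -/
def choiTrace : SuperOp p p →ₗ[ℂ] ℂ where
  toFun N := (N 1).trace
  map_add' M N := by simp
  map_smul' z N := by simp

theorem choiTrace_apply (N : SuperOp p p) : choiTrace N = (N 1).trace := rfl

/-- Sandwiching a matrix unit factors each entry into diagonal entries of `Gᴴ M` and of its adjoint,
so the double sum is a trace times its conjugate. -/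
theorem choiOverlap_conjMap (G M : Matrix p p ℂ) :
    choiOverlap G (conjMap M) = ((‖(Gᴴ * M).trace‖ ^ 2 : ℝ) : ℂ) := by
  have h : ∀ (X Y : Matrix p p ℂ) (x y i j : p),
      (X * single x y (1 : ℂ) * Y) i j = X i x * Y y j := by
    intro X Y x y i j
    simp [Matrix.mul_apply, single_apply, ite_and]
  have h1 : ∀ x y, (Gᴴ * conjMap M (single x y 1) * G) x y = (Gᴴ * M) x x * (Mᴴ * G) y y := by
    intro x y
    rw [← h, conjMap_apply]
    simp only [Matrix.mul_assoc]
  change ∑ x, ∑ y, (Gᴴ * conjMap M (single x y 1) * G) x y = _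
  simp only [h1]
  rw [← Finset.sum_mul_sum]
  change (Gᴴ * M).trace * (Mᴴ * G).trace = _
  have h2 : (Mᴴ * G).trace = star (Gᴴ * M).trace := by
    rw [← trace_conjTranspose, conjTranspose_mul, conjTranspose_conjTranspose]
  rw [h2, Complex.star_def, Complex.mul_conj, Complex.normSq_eq_norm_sq]

/-- The entanglement witness associated with `G`, evaluated on the Choi matrix of a map. -/
def choiWitness (G : Matrix p p ℂ) : SuperOp p p →ₗ[ℂ] ℂ :=
  (2 / (Fintype.card p : ℂ) ^ 2) • choiOverlap G - (1 / (Fintype.card p : ℂ)) • choiTrace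

variable {A B : Type} [Fintype A] [DecidableEq A] [Nonempty A] [Fintype B] [DecidableEq B]
  [Nonempty B]

variable {ι : Type} [Fintype ι] [DecidableEq ι] {V : ι → Matrix A A ℂ} {W : ι → Matrix B B ℂ}

/-- With `τ` the right-hand side, the overlap divided by `D²` lies in `[0, τ]`. The weights `2` and
`-1` of the witness map this interval to the symmetric `[-τ, τ]`. -/
theorem norm_choiWitness_conjMap_le
    (hV : ∀ j k, ((V j)ᴴ * V k).trace = if j = k then (Fintype.card A : ℂ) else 0)
    (hW : ∀ j k, ((W j)ᴴ * W k).trace = if j = k then (Fintype.card B : ℂ) else 0)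
    (K : Matrix A A ℂ) (L : Matrix B B ℂ) :
    ‖choiWitness (∑ j, V j ⊗ₖ W j) (conjMap (K ⊗ₖ L))‖ ≤
      ((1 / (Fintype.card (A × B) : ℂ)) * choiTrace (conjMap (K ⊗ₖ L))).re := by
  have hD : (0 : ℝ) < Fintype.card (A × B) := by exact_mod_cast Fintype.card_pos
  have hDc : ((Fintype.card (A × B) : ℝ) : ℂ) = (Fintype.card (A × B) : ℂ) := by simp
  have hDm : (Fintype.card (A × B) : ℝ) = Fintype.card A * Fintype.card B := by simp
  set D : ℝ := ((Fintype.card (A × B) : ℕ) : ℝ)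
  have htr : choiTrace (conjMap (K ⊗ₖ L)) = (Kᴴ * K).trace * (Lᴴ * L).trace := by
    rw [choiTrace_apply, trace_conjMap, Matrix.mul_one, conjTranspose_kronecker,
      ← mul_kronecker_mul, trace_kronecker]
  have hreal : ∀ {q : Type} [Fintype q] (M : Matrix q q ℂ),
      (Mᴴ * M).trace = (((Mᴴ * M).trace.re : ℝ) : ℂ) ∧ 0 ≤ (Mᴴ * M).trace.re := by
    intro q _ M
    open scoped ComplexOrder in
    have h0 := (posSemidef_conjTranspose_mul_self M).trace_nonneg
    have := Complex.le_def.1 h0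
    exact ⟨Complex.ext (by simp) (by simpa using this.2.symm), this.1⟩
  obtain ⟨hK, hK0⟩ := hreal K
  obtain ⟨hL, hL0⟩ := hreal L
  have hGt : ((∑ j, V j ⊗ₖ W j)ᴴ * (K ⊗ₖ L)).trace =
      ∑ j, ((V j)ᴴ * K).trace * ((W j)ᴴ * L).trace := by
    simp only [conjTranspose_sum, Finset.sum_mul, trace_sum, conjTranspose_kronecker,
      ← mul_kronecker_mul, trace_kronecker]
  set k := (Kᴴ * K).trace.re
  set l := (Lᴴ * L).trace.re
  have hbound : ‖((∑ j, V j ⊗ₖ W j)ᴴ * (K ⊗ₖ L)).trace‖ ^ 2 ≤ D * (k * l) := by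
    rw [hGt]
    calc ‖∑ j, ((V j)ᴴ * K).trace * ((W j)ᴴ * L).trace‖ ^ 2
        ≤ (∑ j, ‖((V j)ᴴ * K).trace‖ * ‖((W j)ᴴ * L).trace‖) ^ 2 := by
          gcongr
          exact (norm_sum_le _ _).trans (by simp)
      _ ≤ (∑ j, ‖((V j)ᴴ * K).trace‖ ^ 2) * ∑ j, ‖((W j)ᴴ * L).trace‖ ^ 2 :=
          Finset.sum_mul_sq_le_sq_mul_sq _ _ _
      _ ≤ (Fintype.card A * k) * (Fintype.card B * l) := by
          gcongr
          · exact sum_norm_trace_sq_le hV K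
          · exact sum_norm_trace_sq_le hW L
      _ = D * (k * l) := by rw [hDm]; ring
  have hval : choiWitness (∑ j, V j ⊗ₖ W j) (conjMap (K ⊗ₖ L)) =
      ((2 / D ^ 2 * ‖((∑ j, V j ⊗ₖ W j)ᴴ * (K ⊗ₖ L)).trace‖ ^ 2 - 1 / D * (k * l) : ℝ) : ℂ) := by
    simp only [choiWitness, LinearMap.sub_apply, LinearMap.smul_apply, choiOverlap_conjMap, htr,
      smul_eq_mul, ← hDc]
    rw [hK, hL]
    push_cast
    rfl
  rw [hval, htr, hK, hL, ← hDc, Complex.norm_real]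
  have hre : (1 / (D : ℂ) * ((k : ℂ) * (l : ℂ))).re = 1 / D * (k * l) := by
    norm_cast
  rw [hre, Real.norm_eq_abs, abs_le]
  have h1 : 2 / D ^ 2 * ‖((∑ j, V j ⊗ₖ W j)ᴴ * (K ⊗ₖ L)).trace‖ ^ 2 ≤ 2 * (1 / D * (k * l)) := by
    calc _ ≤ 2 / D ^ 2 * (D * (k * l)) := by gcongr
      _ = _ := by field_simp
  have h2 : 0 ≤ 2 / D ^ 2 * ‖((∑ j, V j ⊗ₖ W j)ᴴ * (K ⊗ₖ L)).trace‖ ^ 2 := by positivity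
  constructor <;> linarith

theorem IsSeparable.norm_choiWitness_le
    (hV : ∀ j k, ((V j)ᴴ * V k).trace = if j = k then (Fintype.card A : ℂ) else 0)
    (hW : ∀ j k, ((W j)ᴴ * W k).trace = if j = k then (Fintype.card B : ℂ) else 0)
    {Λ : SuperOp (A × B) (A × B)} (hΛ : IsSeparable Λ) :
    ‖choiWitness (∑ j, V j ⊗ₖ W j) Λ‖ ≤
      ((1 / (Fintype.card (A × B) : ℂ)) * choiTrace Λ).re := by
  obtain ⟨κ, _, K, L, rfl⟩ := hΛ
  simp only [map_sum, Finset.mul_sum, Complex.re_sum]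
  exact (norm_sum_le _ _).trans
    (Finset.sum_le_sum fun i _ => norm_choiWitness_conjMap_le hV hW (K i) (L i))

/-- One term of a space-like cut has witness value at most `1`. -/
theorem IsLOCC.norm_choiWitness_postProcess_le {RA RB : Type} [Fintype RA] [DecidableEq RA]
    [Fintype RB] [DecidableEq RB]
    (hV : ∀ j k, ((V j)ᴴ * V k).trace = if j = k then (Fintype.card A : ℂ) else 0)
    (hW : ∀ j k, ((W j)ᴴ * W k).trace = if j = k then (Fintype.card B : ℂ) else 0)
    {Λ : SuperOp (A × B) ((A × RA) × (B × RB))} (hΛ : IsLOCC A B Λ)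
    {P : Matrix RA RA ℂ} {Q : Matrix RB RB ℂ} (hPQ : opNorm (P ⊗ₖ Q) ≤ 1) :
    ‖choiWitness (∑ j, V j ⊗ₖ W j) ((postProcess (P ⊗ₖ Q)).comp Λ)‖ ≤ 1 := by
  obtain ⟨P', Q', hP', hQ', heq⟩ := exists_contraction_kronecker hPQ
  rw [heq]
  let T : SuperOp ((A × RA) × (B × RB)) (A × B) →ₗ[ℂ] SuperOp (A × B) (A × B) :=
    LinearMap.lcomp ℂ _ Λ
  have h := norm_le_of_posSemidef_bound
    (postProcessProd.compr₂ ((choiWitness (∑ j, V j ⊗ₖ W j)).comp T))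
    (postProcessProd.compr₂ (((1 / (Fintype.card (A × B) : ℂ)) • choiTrace).comp T))
    (fun E F hE hF => IsSeparable.norm_choiWitness_le hV hW
      ((isSeparable_postProcessProd hE hF).comp hΛ.isSeparable)) hP' hQ'
  refine h.trans_eq ?_
  -- Identity observables merely discard the ancillas, so trace preservation of `Λ` leaves `Tr 1 /
  -- D`.
  change ((1 / (Fintype.card (A × B) : ℂ)) * (postProcessProd 1 1 (Λ 1)).trace).re = 1
  rw [trace_postProcess_one, hΛ.trace_apply, trace_one, one_div,
    inv_mul_cancel₀ (Nat.cast_ne_zero.2 Fintype.card_ne_zero), Complex.one_re]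

theorem CutData.IsSpaceLikeCut.norm_choiWitness_le_oneNorm {κ RA RB : Type} [Fintype κ]
    [Fintype RA] [DecidableEq RA] [Fintype RB] [DecidableEq RB]
    (hV : ∀ j k, ((V j)ᴴ * V k).trace = if j = k then (Fintype.card A : ℂ) else 0)
    (hW : ∀ j k, ((W j)ᴴ * W k).trace = if j = k then (Fintype.card B : ℂ) else 0)
    {D : CutData κ A B RA RB} {N : SuperOp (A × B) (A × B)} (hD : D.IsSpaceLikeCut N) :
    ‖choiWitness (∑ j, V j ⊗ₖ W j) N‖ ≤ D.oneNorm := by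
  rw [hD.decomp, map_sum]
  refine (norm_sum_le _ _).trans (Finset.sum_le_sum fun i _ => ?_)
  rw [map_smul, norm_smul, Complex.norm_real, Real.norm_eq_abs]
  exact mul_le_of_le_one_right (abs_nonneg _)
    ((hD.locc i).norm_choiWitness_postProcess_le hV hW (hD.norm_obs_le i))

theorem choiWitness_unitaryChannel (U : Matrix.unitaryGroup (A × B) ℂ)
    {Γ : LocalDecomposition A B} (hΓ : Γ.IsValidFor U) (hS : Γ.IsOperatorSchmidt) :
    choiWitness (∑ j, (Γ.V j : Matrix A A ℂ) ⊗ₖ (Γ.W j : Matrix B B ℂ)) (unitaryChannel U) =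
      ((2 * (∑ i, |Γ.c i|) ^ 2 - 1 : ℝ) : ℂ) := by
  have hDc : (Fintype.card (A × B) : ℂ) ≠ 0 := Nat.cast_ne_zero.2 Fintype.card_ne_zero
  have htr : ((∑ j, (Γ.V j : Matrix A A ℂ) ⊗ₖ (Γ.W j : Matrix B B ℂ))ᴴ *
      (U : Matrix (A × B) (A × B) ℂ)).trace =
        (((Fintype.card (A × B) : ℝ) * ∑ i, |Γ.c i| : ℝ) : ℂ) := by
    rw [show (U : Matrix (A × B) (A × B) ℂ) = _ from hΓ]
    simp only [conjTranspose_sum, Finset.sum_mul, Finset.mul_sum, trace_sum, Matrix.mul_smul,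
      trace_smul, conjTranspose_kronecker, ← mul_kronecker_mul, trace_kronecker, hS.trace_V,
      hS.trace_W]
    simp [abs_of_pos (hS.c_pos _), mul_comm]
  have hone : choiTrace (unitaryChannel U) = (Fintype.card (A × B) : ℂ) := by
    have hU : (U : Matrix (A × B) (A × B) ℂ)ᴴ * (U : Matrix (A × B) (A × B) ℂ) = 1 :=
      Unitary.coe_star_mul_self U
    rw [choiTrace_apply, unitaryChannel, trace_conjMap, hU, Matrix.mul_one, trace_one]
  simp only [choiWitness, LinearMap.sub_apply, LinearMap.smul_apply, hone, smul_eq_mul]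
  rw [unitaryChannel, choiOverlap_conjMap, htr, Complex.norm_real, Real.norm_eq_abs, sq_abs]
  push_cast
  field_simp

/-- Every space-like cut of `U` has 1-norm at least `2 ‖c‖₁² - 1`, where `c` is the vector of
operator Schmidt coefficients. -/
theorem CutData.IsSpaceLikeCut.le_oneNorm {κ RA RB : Type} [Fintype κ] [Fintype RA]
    [DecidableEq RA] [Fintype RB] [DecidableEq RB] (U : Matrix.unitaryGroup (A × B) ℂ)
    {Γ : LocalDecomposition A B} (hΓ : Γ.IsValidFor U) (hS : Γ.IsOperatorSchmidt)
    {D : CutData κ A B RA RB} (hD : D.IsSpaceLikeCut (unitaryChannel U)) :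
    2 * (∑ i, |Γ.c i|) ^ 2 - 1 ≤ D.oneNorm := by
  have h := hD.norm_choiWitness_le_oneNorm hS.trace_V hS.trace_W
  rw [choiWitness_unitaryChannel U hΓ hS, Complex.norm_real] at h
  exact (le_abs_self _).trans h

end Witness

/-! ### Correctness and cost of the double Hadamard test -/

section HadamardTest

variable {A B : Type} [Fintype A] [DecidableEq A] [Fintype B] [DecidableEq B]

theorem one_kronecker_mul_apply {R c : Type} [Fintype R] (M : Matrix R R ℂ)
    (N : Matrix (A × R) c ℂ) (x : A) (r : R) (y : c) :
    (((1 : Matrix A A ℂ) ⊗ₖ M) * N) (x, r) y = ∑ s, M r s * N (x, s) y := by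
  simp [Matrix.mul_apply, Fintype.sum_prod_type, one_apply, Finset.sum_ite_irrel]

theorem controlledGate_mul_apply {A c : Type} [Fintype A] (X Y : Matrix A A ℂ) (N : Matrix (A × Fin 2) c ℂ)
    (x : A) (r : Fin 2) (y : c) :
    (controlledGate X Y * N) (x, r) y = ∑ x', (if r = 0 then X else Y) x x' * N (x', r) y := by
  fin_cases r <;>
    simp [controlledGate, Matrix.mul_apply, Fintype.sum_prod_type, single_apply]

/-- The block at ancilla outcome `r` is `(X + (-1)^r i^g Y) / 2`; the two Hadamard gates supply the
`1/2`. -/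
theorem hadamardTestIsometry_apply (X Y : Matrix A A ℂ) (g r : Fin 2) (x y : A) :
    hadamardTestIsometry X Y g (x, r) y =
      2⁻¹ * (X x y + (-1) ^ (r : ℕ) * Complex.I ^ (g : ℕ) * Y x y) := by
  have h2 : ((√2 : ℝ) : ℂ)⁻¹ * ((√2 : ℝ) : ℂ)⁻¹ = 2⁻¹ := by
    rw [← mul_inv, ← Complex.ofReal_mul, Real.mul_self_sqrt (by norm_num)]
    norm_num
  have hH : ∀ r : Fin 2, hadamardGate r 0 = ((√2 : ℝ) : ℂ)⁻¹ := by
    intro r; fin_cases r <;> simp [hadamardGate]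
  have hH1 : ∀ r : Fin 2, hadamardGate r 1 = (-1) ^ (r : ℕ) * ((√2 : ℝ) : ℂ)⁻¹ := by
    intro r; fin_cases r <;> simp [hadamardGate]
  have hG : ∀ s t : Fin 2, phaseGate g s t =
      if s = t then (if s = 0 then 1 else Complex.I ^ (g : ℕ)) else 0 := by
    intro s t; fin_cases g <;> fin_cases s <;> fin_cases t <;> simp [phaseGate]
  have hadd : ∀ (x' : A) (s : Fin 2),
      (((1 : Matrix A A ℂ) ⊗ₖ hadamardGate) * addAncilla A) (x', s) y =
        if x' = y then ((√2 : ℝ) : ℂ)⁻¹ else 0 := by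
    intro x' s
    rw [one_kronecker_mul_apply]
    simp [addAncilla, hH, ite_and]
  rw [hadamardTestIsometry]
  simp only [Matrix.mul_assoc]
  simp only [one_kronecker_mul_apply, Fin.sum_univ_two, controlledGate_mul_apply, hadd, hH, hH1,
    hG]
  simp only [mul_ite, mul_zero, Finset.sum_ite_eq', Finset.mem_univ, if_true, one_ne_zero,
    zero_ne_one, if_false, zero_mul, add_zero, zero_add, one_mul]
  linear_combination (X x y + (-1) ^ (r : ℕ) * Complex.I ^ (g : ℕ) * Y x y) * h2

theorem partialBra_mul_hadamardTestIsometry (X Y : Matrix A A ℂ) (g r : Fin 2) :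
    partialBra A (Pi.single r 1) * hadamardTestIsometry X Y g =
      (2⁻¹ : ℂ) • (X + ((-1) ^ (r : ℕ) * Complex.I ^ (g : ℕ)) • Y) := by
  ext x y
  simp [Matrix.mul_apply, partialBra_apply, Fintype.sum_prod_type, hadamardTestIsometry_apply,
    Pi.single_apply, Finset.sum_ite_irrel]

theorem conjTranspose_mul_self_eq_sum {A R c : Type} [Fintype A] [Fintype R] {K : Matrix (A × R) c ℂ}
    {T : R → Matrix A c ℂ} (hT : ∀ x r y, K (x, r) y = T r x y) :
    Kᴴ * K = ∑ r, (T r)ᴴ * T r := by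
  ext y z
  rw [Matrix.sum_apply, Matrix.mul_apply, Fintype.sum_prod_type, Finset.sum_comm]
  refine Finset.sum_congr rfl fun r _ => ?_
  rw [Matrix.mul_apply]
  exact Finset.sum_congr rfl fun x _ => by simp only [conjTranspose_apply, hT]

theorem conjTranspose_mul_hadamardTestIsometry {X Y : Matrix A A ℂ} (hX : Xᴴ * X = 1)
    (hY : Yᴴ * Y = 1) (g : Fin 2) :
    (hadamardTestIsometry X Y g)ᴴ * hadamardTestIsometry X Y g = 1 := by
  rw [conjTranspose_mul_self_eq_sum
    (T := fun r : Fin 2 => (2⁻¹ : ℂ) • (X + ((-1) ^ (r : ℕ) * Complex.I ^ (g : ℕ)) • Y))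
    (fun x r y => by simp [hadamardTestIsometry_apply])]
  simp only [Fin.sum_univ_two, conjTranspose_smul,
    conjTranspose_add, Matrix.mul_add, Matrix.add_mul, Matrix.smul_mul, Matrix.mul_smul, smul_add,
    smul_smul, hX, hY]
  fin_cases g <;> simp <;> match_scalars <;> ring_nf <;> norm_num

theorem pauliZ_eq : pauliZ = vecMulVec (star (Pi.single 0 1)) (Pi.single 0 1) -
    vecMulVec (star (Pi.single 1 1)) (Pi.single 1 1) := by
  ext i j
  fin_cases i <;> fin_cases j <;> simp [pauliZ, vecMulVec_apply]

/-- The two ancilla measurements applied to the output of the two local circuits. -/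
theorem postProcess_pauliZ_hadamardTest (X Y : Matrix A A ℂ) (X' Y' : Matrix B B ℂ) (g : Fin 2)
    (ρ : Matrix (A × B) (A × B) ℂ) :
    postProcess (pauliZ ⊗ₖ pauliZ)
      (conjMap (hadamardTestIsometry X Y g ⊗ₖ hadamardTestIsometry X' Y' g) ρ) =
      (4⁻¹ : ℂ) • ((-1 : ℂ) ^ (g : ℕ) • ((X ⊗ₖ X') * ρ * (Y ⊗ₖ Y')ᴴ + (Y ⊗ₖ Y') * ρ * (X ⊗ₖ X')ᴴ) +
        ((X ⊗ₖ Y') * ρ * (Y ⊗ₖ X')ᴴ + (Y ⊗ₖ X') * ρ * (X ⊗ₖ Y')ᴴ)) := by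
  rw [← postProcessProd_apply, pauliZ_eq]
  -- The signed sum over the four outcomes keeps the terms with exactly one `Y` and exactly one `Y'`
  -- among the left and right factors. If these stand on the same side of `ρ`, the phases multiply
  -- to `(-1)^g`, otherwise to `1`.
  simp only [map_sub, LinearMap.sub_apply, postProcessProd_vecMulVec]
  simp only [← LinearMap.comp_apply, conjMap_comp, ← mul_kronecker_mul,
    partialBra_mul_hadamardTestIsometry]
  simp only [conjMap_apply, smul_kronecker, kronecker_smul, add_kronecker, kronecker_add, smul_add,
    smul_smul, conjTranspose_add, conjTranspose_smul, Matrix.add_mul, Matrix.mul_add,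
    Matrix.smul_mul, Matrix.mul_smul]
  fin_cases g <;> simp <;> match_scalars <;> ring_nf <;> simp <;> norm_num

variable (Γ : LocalDecomposition A B)

theorem doubleHadamardTest_isLocal : Γ.doubleHadamardTest.IsLocal := fun ⟨i, j, g⟩ =>
  ⟨_, _, conjTranspose_mul_hadamardTestIsometry (Unitary.coe_star_mul_self (Γ.V i))
      (Unitary.coe_star_mul_self (Γ.V j)) g,
    conjTranspose_mul_hadamardTestIsometry (Unitary.coe_star_mul_self (Γ.W i))
      (Unitary.coe_star_mul_self (Γ.W j)) g, rfl⟩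

theorem CutData.IsLocal.isLOCC {ι RA RB : Type} [Fintype RA] [Fintype RB]
    {D : CutData ι A B RA RB} (hD : D.IsLocal) (i : ι) : IsLOCC A B (D.chan i) := by
  obtain ⟨V, W, hV, hW, h⟩ := hD i
  rw [h]
  simpa using IsLOCC.localOps (κ := Unit) (μ := Unit) (fun _ => V) (fun _ => W) (by simpa using hV)
    (by simpa using hW)

theorem opNorm_pauliZ_kronecker_le : opNorm (pauliZ ⊗ₖ pauliZ) ≤ 1 := by
  have hZ : pauliZ ∈ Matrix.unitaryGroup (Fin 2) ℂ := by
    rw [Matrix.mem_unitaryGroup_iff]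
    ext i j
    fin_cases i <;> fin_cases j <;> simp [pauliZ, star_eq_conjTranspose, Matrix.mul_apply]
  open scoped Matrix.Norms.L2Operator in
  exact (CStarRing.norm_of_mem_unitary (kronecker_mem_unitary hZ hZ)).le

theorem sum_doubleHadamardTest_terms (i j : Fin Γ.m) (ρ : Matrix (A × B) (A × B) ℂ) :
    ∑ g : Fin 2, (Γ.doubleHadamardTest.coeff (i, j, g) : ℂ) •
      postProcess (pauliZ ⊗ₖ pauliZ) (Γ.doubleHadamardTest.chan (i, j, g) ρ) =
    ((Γ.c i : ℂ) * Γ.c j * 2⁻¹) •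
      (((Γ.V i : Matrix A A ℂ) ⊗ₖ (Γ.W i : Matrix B B ℂ)) * ρ *
          ((Γ.V j : Matrix A A ℂ) ⊗ₖ (Γ.W j : Matrix B B ℂ))ᴴ +
        ((Γ.V j : Matrix A A ℂ) ⊗ₖ (Γ.W j : Matrix B B ℂ)) * ρ *
          ((Γ.V i : Matrix A A ℂ) ⊗ₖ (Γ.W i : Matrix B B ℂ))ᴴ) := by
  simp only [LocalDecomposition.doubleHadamardTest, postProcess_pauliZ_hadamardTest,
    Fin.sum_univ_two]
  -- On the diagonal, direct and cross terms agree and `g = 0` alone gives the right weight; off it,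
  -- the difference of the two settings cancels the cross terms.
  by_cases h : i = j
  · subst h
    simp
    module
  · simp [h]
    module

theorem doubleHadamardTest_decomp {U : Matrix.unitaryGroup (A × B) ℂ} (hΓ : Γ.IsValidFor U) :
    unitaryChannel U = ∑ i, (Γ.doubleHadamardTest.coeff i : ℂ) •
      (postProcess (Γ.doubleHadamardTest.obsA i ⊗ₖ Γ.doubleHadamardTest.obsB i)).comp
        (Γ.doubleHadamardTest.chan i) := by
  ext1 ρ
  rw [unitaryChannel, conjMap_apply, show (U : Matrix (A × B) (A × B) ℂ) = _ from hΓ]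
  simp only [LinearMap.sum_apply, LinearMap.smul_apply, LinearMap.comp_apply,
    Fintype.sum_prod_type]
  have h : ∀ i j, ∑ g : Fin 2, (Γ.doubleHadamardTest.coeff (i, j, g) : ℂ) •
      postProcess (Γ.doubleHadamardTest.obsA (i, j, g) ⊗ₖ Γ.doubleHadamardTest.obsB (i, j, g))
        (Γ.doubleHadamardTest.chan (i, j, g) ρ) = _ := fun i j =>
    sum_doubleHadamardTest_terms Γ i j ρ
  simp only [h]
  set S : Fin Γ.m → Fin Γ.m → Matrix (A × B) (A × B) ℂ := fun i j =>
    ((Γ.c i : ℂ) * Γ.c j) • (((Γ.V i : Matrix A A ℂ) ⊗ₖ (Γ.W i : Matrix B B ℂ)) * ρ *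
      ((Γ.V j : Matrix A A ℂ) ⊗ₖ (Γ.W j : Matrix B B ℂ))ᴴ) with hS
  have h1 : ∀ i j, ((Γ.c i : ℂ) * Γ.c j * 2⁻¹) •
      (((Γ.V i : Matrix A A ℂ) ⊗ₖ (Γ.W i : Matrix B B ℂ)) * ρ *
          ((Γ.V j : Matrix A A ℂ) ⊗ₖ (Γ.W j : Matrix B B ℂ))ᴴ +
        ((Γ.V j : Matrix A A ℂ) ⊗ₖ (Γ.W j : Matrix B B ℂ)) * ρ *
          ((Γ.V i : Matrix A A ℂ) ⊗ₖ (Γ.W i : Matrix B B ℂ))ᴴ) =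
      (2⁻¹ : ℂ) • S i j + (2⁻¹ : ℂ) • S j i := by
    intro i j
    simp only [hS]
    module
  simp only [h1, Finset.sum_add_distrib, ← Finset.smul_sum]
  -- Summed over all ordered pairs, the two halves of the symmetrized term agree.
  rw [Finset.sum_comm (f := fun i j => S j i), ← add_smul]
  have h2 : (2⁻¹ + 2⁻¹ : ℂ) = 1 := by norm_num
  rw [h2, one_smul]
  simp only [conjTranspose_sum, Finset.sum_mul, Finset.mul_sum, hS, conjTranspose_smul,
    Matrix.smul_mul, Matrix.mul_smul, smul_smul, Complex.star_def, Complex.conj_ofReal]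
  rw [Finset.sum_comm]
  simp only [mul_comm]

theorem doubleHadamardTest_isSpaceLikeCut {U : Matrix.unitaryGroup (A × B) ℂ}
    (hΓ : Γ.IsValidFor U) : Γ.doubleHadamardTest.IsSpaceLikeCut (unitaryChannel U) where
  locc := (doubleHadamardTest_isLocal Γ).isLOCC
  norm_obs_le _ := opNorm_pauliZ_kronecker_le
  decomp := doubleHadamardTest_decomp Γ hΓ

theorem doubleHadamardTest_oneNorm : Γ.doubleHadamardTest.oneNorm = Γ.magnitude := by
  have h : ∀ i j, ∑ g : Fin 2, |Γ.doubleHadamardTest.coeff (i, j, g)| =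
      2 * (|Γ.c i| * |Γ.c j|) - if i = j then Γ.c i ^ 2 else 0 := by
    intro i j
    rw [Fin.sum_univ_two]
    by_cases h : i = j
    · subst h
      simp only [LocalDecomposition.doubleHadamardTest]
      simp
      rw [← sq]
      ring
    · simp [LocalDecomposition.doubleHadamardTest, h, abs_mul]
      ring
  simp only [CutData.oneNorm, Fintype.sum_prod_type, h, Finset.sum_sub_distrib,
    LocalDecomposition.magnitude]
  rw [sq, Finset.sum_mul_sum]
  simp [Finset.mul_sum]

end HadamardTest

/-! ### Comparing the two infima -/

section Extremality

variable {A B : Type} [Fintype A] [DecidableEq A] [Fintype B] [DecidableEq B]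

theorem CutData.oneNorm_nonneg {ι A B RA RB : Type} [Fintype ι] (D : CutData ι A B RA RB) :
    0 ≤ D.oneNorm :=
  Finset.sum_nonneg fun _ _ => abs_nonneg _

/-- Bridges the triple-indexed test and `gammaFactor`, which only admits cuts indexed by `Fin m`. -/
theorem exists_reindexed_cut {ι : Type} [Fintype ι] {rA rB : ℕ} {N : SuperOp (A × B) (A × B)}
    {D : CutData ι A B (Fin rA) (Fin rB)} (hD : D.IsSpaceLikeCut N) :
    ∃ (m rA rB : ℕ) (D' : CutData (Fin m) A B (Fin rA) (Fin rB)),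
      D'.IsSpaceLikeCut N ∧ D'.oneNorm = D.oneNorm := by
  let e := (Fintype.equivFin ι).symm
  refine ⟨Fintype.card ι, rA, rB, ⟨D.coeff ∘ e, D.chan ∘ e, D.obsA ∘ e, D.obsB ∘ e⟩,
    ⟨fun i => hD.locc _, fun i => hD.norm_obs_le _, ?_⟩, ?_⟩
  · rw [hD.decomp]
    exact (Equiv.sum_comp e fun i => (D.coeff i : ℂ) •
      (postProcess (D.obsA i ⊗ₖ D.obsB i)).comp (D.chan i)).symm
  · exact Equiv.sum_comp e fun i => |D.coeff i|

theorem gammaFactor_le_oneNorm {ι : Type} [Fintype ι] {rA rB : ℕ} {N : SuperOp (A × B) (A × B)}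
    {D : CutData ι A B (Fin rA) (Fin rB)} (hD : D.IsSpaceLikeCut N) :
    gammaFactor N ≤ D.oneNorm := by
  refine csInf_le ⟨0, ?_⟩ (exists_reindexed_cut hD)
  rintro t ⟨m, rA, rB, D, -, rfl⟩
  exact D.oneNorm_nonneg

theorem gammaFactor_le_magnitude {U : Matrix.unitaryGroup (A × B) ℂ} {Γ : LocalDecomposition A B}
    (hΓ : Γ.IsValidFor U) : gammaFactor (unitaryChannel U) ≤ Γ.magnitude :=
  (gammaFactor_le_oneNorm (doubleHadamardTest_isSpaceLikeCut Γ hΓ)).trans_eq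
    (doubleHadamardTest_oneNorm Γ)

variable {U : Matrix.unitaryGroup (A × B) ℂ} {Γ : LocalDecomposition A B}

theorem le_gammaFactor [Nonempty A] [Nonempty B] (hΓ : Γ.IsValidFor U)
    (hS : Γ.IsOperatorSchmidt) :
    2 * (∑ i, |Γ.c i|) ^ 2 - 1 ≤ gammaFactor (unitaryChannel U) := by
  -- The double Hadamard test shows that the set of 1-norms is nonempty, so the infimum is not the
  -- default value `0`.
  refine le_csInf ⟨_, exists_reindexed_cut (doubleHadamardTest_isSpaceLikeCut Γ hΓ)⟩ ?_
  rintro t ⟨m, rA, rB, D, hD, rfl⟩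
  exact hD.le_oneNorm U hΓ hS

theorem LocalDecomposition.IsOperatorSchmidt.magnitude_eq (hS : Γ.IsOperatorSchmidt) :
    Γ.magnitude = 2 * (∑ i, |Γ.c i|) ^ 2 - 1 := by
  rw [LocalDecomposition.magnitude, hS.sum_sq]

theorem gammaFactor_eq [Nonempty A] [Nonempty B] (hΓ : Γ.IsValidFor U)
    (hS : Γ.IsOperatorSchmidt) :
    gammaFactor (unitaryChannel U) = 2 * (∑ i, |Γ.c i|) ^ 2 - 1 :=
  ((gammaFactor_le_magnitude hΓ).trans_eq hS.magnitude_eq).antisymm (le_gammaFactor hΓ hS)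

theorem productExtent_eq_magnitude [Nonempty A] [Nonempty B] (hΓ : Γ.IsValidFor U)
    (hS : Γ.IsOperatorSchmidt) : productExtent U = Γ.magnitude := by
  refine IsLeast.csInf_eq ⟨⟨Γ, hΓ, rfl⟩, ?_⟩
  rintro t ⟨Γ', hΓ', rfl⟩
  -- The competitor need not be a Schmidt decomposition: its own double Hadamard test is a cut, so
  -- its magnitude is at least `γ`.
  rw [hS.magnitude_eq, ← gammaFactor_eq hΓ hS]
  exact gammaFactor_le_magnitude hΓ'

end Extremality

end SpaceLikeCutting

end

open SpaceLikeCutting in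
theorem theorem1 {A B : Type} [Fintype A] [DecidableEq A] [Nonempty A]
    [Fintype B] [DecidableEq B] [Nonempty B]
    (U : Matrix.unitaryGroup (A × B) ℂ) (Γ : LocalDecomposition A B) (hΓ : Γ.IsValidFor U) :
    (Γ.doubleHadamardTest.IsSpaceLikeCut (unitaryChannel U) ∧
      Γ.doubleHadamardTest.IsLocal ∧
      Γ.doubleHadamardTest.oneNorm = Γ.magnitude) ∧
    (Γ.IsOperatorSchmidt →
      Γ.magnitude = productExtent U ∧
      productExtent U = gammaFactor (unitaryChannel U) ∧
      gammaFactor (unitaryChannel U) = 2 * (∑ i, |Γ.c i|) ^ 2 - 1) := by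
  exact ⟨⟨doubleHadamardTest_isSpaceLikeCut Γ hΓ, doubleHadamardTest_isLocal Γ,
      doubleHadamardTest_oneNorm Γ⟩, fun hS =>
    ⟨(productExtent_eq_magnitude hΓ hS).symm,
      (productExtent_eq_magnitude hΓ hS).trans (hS.magnitude_eq.trans (gammaFactor_eq hΓ hS).symm),
      gammaFactor_eq hΓ hS⟩⟩
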